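/- For integers $k_1,\dots,k_m\ge 1$ and $N\ge 1$ let $$\zeta(k_1,\dots,k_m)=\sum_{n_1>n_2>\cdots>n_m>0}\frac{1}{n_1^{k_1}\cdots n_m^{k_m}},\qquad \zeta_N(k_1,\dots,k_m)=\sum_{N\ge n_1>n_2>\cdots>n_m>0}\frac{1}{n_1^{k_1}\cdots n_m^{k_m}}.$$ For $m\le 3$ the series $\zeta(k_1,\dots,k_m)$ converges whenever $k_1\ge 2$. For integers $p\ge2$, $q\ge1$, $$\lim_{N\to\infty}\bigl(\zeta_N(1)\zeta_N(p,q)-\zeta_N(1,p,q)\bigr)=D(p,q):=\zeta(p,q,1)+\zeta(p,1,q)+\zeta(p+1,q)+\zeta(p,q+1).$$ Let $a\ge 2$, $b\ge 1$, $c\ge 1$ be integers. Then (1) $$\begin{aligned}\zeta(a,b,c)={}&(-1)^c\sum_{n=1}^b\binom{b+c-n-1}{c-1}\zeta(a,n,b+c-n)\\ &+(-1)^c\sum_{n=1}^c\sum_{m=1}^a\binom{b+c-n-1}{b-1}\binom{a-m+n-1}{n-1}\zeta(m,a-m+n,b-n+c)\\ &+\sum_{n=1}^c\sum_{m=1}^n(-1)^{c-m}\binom{a-m+n-1}{a-1}\binom{b-n+c-1}{b-1}\zeta(m)\,\zeta(a-m+n,b-n+c),\end{aligned}$$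 and alternatively, with $\binom{i+j+l}{i,j,l}=\frac{(i+j+l)!}{i!\,j!\,l!}$, (2) $$\begin{aligned}\zeta(a,b,c)={}&(-1)^b\sum_{n=1}^c\Biggl[\sum_{m=1}^a\binom{a+b+c-m-n-1}{b-1,\,a-m,\,c-n}\zeta(m,a+b+c-m-n,n)\\ &\quad+\sum_{m=1}^{b+c-n}(-1)^m\binom{b+c-n-1}{b-1}\binom{a+b+c-m-n-1}{a-1}\zeta(m)\,\zeta(a+b+c-m-n,n)\Biggr]\\ &+\sum_{n=1}^b(-1)^c\binom{b+c-n-1}{c-1}\zeta(a,n,b+c-n).\end{aligned}$$ The divergent terms ($m=1$) on the right-hand sides occur only in combinations $\zeta(1)\zeta(p,q)-\zeta(1,p,q)$ with $p\ge2$, $q\ge1$. Both identities hold in each of the following two senses: (i) the right-hand side with every $\zeta$ replaced by $\zeta_N$ tends to $\zeta(a,b,c)$ as $N\to\infty$; (ii) the identity holds exactly between convergent series after every combination $\zeta(1)\zeta(p,q)-\zeta(1,p,q)$ is replaced by $D(p,q)$. Explicitly, in (ii) the sums over $m$ start at $m=2$, and the $m=1$ terms are replaced in (1) by $$-(-1)^c\sum_{n=1}^c\binom{a+n-2}{a-1}\binom{b+c-n-1}{b-1}D(a+n-1,\,b+c-n)$$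 and in (2) by $$-(-1)^b\sum_{n=1}^c\binom{b+c-n-1}{b-1}\binom{a+b+c-n-2}{a-1}D(a+b+c-n-1,\,n).$$ -/

import Mathlib

open Filter Topology

noncomputable section

/-- The index set of the Euler-Zagier sum of length `m`:
tuples `n₁ > n₂ > ⋯ > n_m > 0` of natural numbers. -/
def MZVIndex (m : ℕ) : Type :=
  {n : Fin m → ℕ // StrictAnti n ∧ ∀ i, 0 < n i}

/-- The term `1 / (n₁ ^ k₁ ⋯ n_m ^ k_m)`. -/
def mzvTerm {m : ℕ} (k : Fin m → ℕ) (n : Fin m → ℕ) : ℝ :=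
  ∏ i, 1 / (n i : ℝ) ^ k i

/-- The defining series of `ζ(k₁, …, k_m)` converges (absolutely, all terms being positive). -/
def MZVConverges {m : ℕ} (k : Fin m → ℕ) : Prop :=
  Summable fun n : MZVIndex m => mzvTerm k n.1

/-- The Euler-Zagier sum (multiple zeta value)
`ζ(k₁, …, k_m) = ∑_{n₁ > ⋯ > n_m > 0} 1 / (n₁ ^ k₁ ⋯ n_m ^ k_m)`. -/
def mzv {m : ℕ} (k : Fin m → ℕ) : ℝ :=
  ∑' n : MZVIndex m, mzvTerm k n.1

open Classical in
/-- The truncated sum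
`ζ_N(k₁, …, k_m) = ∑_{N ≥ n₁ > ⋯ > n_m > 0} 1 / (n₁ ^ k₁ ⋯ n_m ^ k_m)`. -/
def mzvTrunc (N : ℕ) {m : ℕ} (k : Fin m → ℕ) : ℝ :=
  ∑ n ∈ (Fintype.piFinset fun _ : Fin m => Finset.Icc 1 N) with StrictAnti n, mzvTerm k n

/-- The trinomial coefficient `(i + j + l)! / (i! j! l!)`. -/
def trinomial (i j l : ℕ) : ℕ :=
  Nat.multinomial Finset.univ ![i, j, l]

end

/-! The decomposition is two successive partial fraction expansions, carried out on finite sums so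
that divergent terms cause no trouble. In the sum over x > y > z of 1/(x^a y^b z^c), reflect z to y
- z and expand 1/(y^b (y-z)^c) in the variable z. The terms in y and z are triple sums again; the
terms in w = y - z and z are Tornheim sums over w + z < x (`tripleSum_eq_add_tornheimSum`). In these
put v = x - w and expand 1/(x^a (x-v)^n) in v (`tornheimSum_eq`): the terms in x and v are triple
sums, those in w = x - v and v are products over the region w + v < M, that is, `truncProd`.
Interchanging w and z before the second expansion gives the alternative formula. All this is exact
for each cutoff. The only analytic input is that replacing the region w + v < M by w, v < M changes
the product by a quantity tending to 0 (`tendsto_singleSum_mul_doubleSum_sub_truncProd`); the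
exponent of v is at least a ≥ 2, so this holds even when w has exponent 1. For the version with
convergent series, the terms m = 1 are paired, and the stuffle product (`singleSum_mul_doubleSum`)
cancels the divergent triple sum in each pair. Uniqueness of limits then gives the identity. -/

/-- `1 + 1/2^p + ⋯ + 1/(M-1)^p`. -/
noncomputable def singleSum (p M : ℕ) : ℝ := ∑ x ∈ Finset.Ico 1 M, 1 / (x : ℝ) ^ p

/-- The sum of `1 / (x^p y^q)` over `M > x > y > 0`. -/
noncomputable def doubleSum (p q M : ℕ) : ℝ :=
  ∑ x ∈ Finset.Ico 1 M, 1 / (x : ℝ) ^ p * singleSum q x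

/-- The sum of `1 / (x^p y^q z^r)` over `M > x > y > z > 0`. -/
noncomputable def tripleSum (p q r M : ℕ) : ℝ :=
  ∑ x ∈ Finset.Ico 1 M, 1 / (x : ℝ) ^ p * doubleSum q r x

/-- The sum of `1 / (w^n z^s)` over `w + z = y`, `w, z > 0`. -/
noncomputable def convSum (n s y : ℕ) : ℝ :=
  ∑ z ∈ Finset.Ico 1 y, 1 / ((y : ℝ) - z) ^ n * (1 / (z : ℝ) ^ s)

/-- The sum of `1 / (x^a w^n z^s)` over `M > x > w + z`, `w, z > 0`. -/
noncomputable def tornheimSum (a n s M : ℕ) : ℝ :=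
  ∑ x ∈ Finset.Ico 1 M, 1 / (x : ℝ) ^ a * ∑ y ∈ Finset.Ico 1 x, convSum n s y

/-- The sum of `1 / (w^m v^p z^s)` over `v > z > 0`, `w > 0` and `w + v < M`. -/
noncomputable def truncProd (m p s M : ℕ) : ℝ :=
  ∑ x ∈ Finset.Ico 1 M, ∑ v ∈ Finset.Ico 1 x,
    1 / ((x : ℝ) - v) ^ m * (1 / (v : ℝ) ^ p * singleSum s v)

/-! ### Partial fractions with binomial coefficients -/

section PartialFractions

/-- One half of the expansion of `U ^ (a + 1) * V ^ (b + 1)` when `U * V = W * (U + V)`. -/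
noncomputable def partialFractionHalf (U W : ℝ) (a b : ℕ) : ℝ :=
  ∑ i ∈ Finset.range (a + 1), ((b + i).choose b : ℝ) * (U ^ (a + 1 - i) * W ^ (b + 1 + i))

/-- Pascal's rule splits each coefficient; in the second part the term i = 0 vanishes, and shifting
the index restores the shape of a half expansion. -/
theorem partialFractionHalf_succ_succ (U W : ℝ) (a b : ℕ) :
    partialFractionHalf U W (a + 1) (b + 1) =
      W * (partialFractionHalf U W (a + 1) b + partialFractionHalf U W a (b + 1)) := by
  have h1 : partialFractionHalf U W (a + 1) (b + 1) =
      ∑ i ∈ Finset.range (a + 2), ((b + i).choose b : ℝ) * (U ^ (a + 2 - i) * W ^ (b + 2 + i)) +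
      ∑ i ∈ Finset.range (a + 2),
        ((b + i).choose (b + 1) : ℝ) * (U ^ (a + 2 - i) * W ^ (b + 2 + i)) := by
    rw [partialFractionHalf, ← Finset.sum_add_distrib]
    refine Finset.sum_congr rfl fun i _ => ?_
    have : (b + 1 + i).choose (b + 1) = (b + i).choose b + (b + i).choose (b + 1) := by
      rw [show b + 1 + i = (b + i) + 1 by omega, Nat.choose_succ_succ]
    rw [this]; push_cast; ring
  rw [h1, mul_add]
  congr 1
  · rw [partialFractionHalf, Finset.mul_sum]
    refine Finset.sum_congr rfl fun i _ => ?_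
    ring
  · rw [Finset.sum_range_succ', partialFractionHalf, Finset.mul_sum]
    simp only [add_zero, Nat.choose_succ_self, Nat.cast_zero, zero_mul]
    refine Finset.sum_congr rfl fun i _ => ?_
    rw [show a + 2 - (i + 1) = a + 1 - i by omega, show b + (i + 1) = b + 1 + i by omega]
    ring

theorem mul_pow_eq_partialFractionHalf_zero {U V W : ℝ} (h : U * V = W * (U + V)) (b : ℕ) :
    U ^ (0 + 1) * V ^ (b + 1) = partialFractionHalf U W 0 b + partialFractionHalf V W b 0 := by
  induction b with
  | zero => simp [partialFractionHalf]; linarith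
  | succ b ih =>
    have h2 : partialFractionHalf V W (b + 1) 0 =
        V ^ (b + 2) * W + W * partialFractionHalf V W b 0 := by
      rw [partialFractionHalf, Finset.sum_range_succ', partialFractionHalf, Finset.mul_sum, add_comm]
      congr 1
      · simp
      · refine Finset.sum_congr rfl fun i _ => ?_
        rw [show b + 1 + 1 - (i + 1) = b + 1 - i by omega]
        simp only [Nat.choose_zero_right]; ring
    have h3 : partialFractionHalf U W 0 (b + 1) = W * partialFractionHalf U W 0 b := by
      simp [partialFractionHalf]; ring
    rw [h2, h3]
    calc U ^ (0 + 1) * V ^ (b + 1 + 1) = (U * V) * V ^ (b + 1) := by ring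
      _ = W * (U ^ (0 + 1) * V ^ (b + 1)) + V ^ (b + 2) * W := by rw [h]; ring
      _ = _ := by rw [ih]; ring

/-- Double induction: trading one factor U * V for W * (U + V) lowers one exponent or the other, and
both halves obey the same recursion. -/
theorem mul_pow_eq_partialFractionHalf {U V W : ℝ} (h : U * V = W * (U + V)) (a b : ℕ) :
    U ^ (a + 1) * V ^ (b + 1) = partialFractionHalf U W a b + partialFractionHalf V W b a := by
  induction a generalizing b with
  | zero => exact mul_pow_eq_partialFractionHalf_zero h b
  | succ a iha =>
    induction b with
    | zero =>
      rw [mul_comm, add_comm (partialFractionHalf U W (a + 1) 0)]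
      exact mul_pow_eq_partialFractionHalf_zero (by rw [mul_comm, h, add_comm]) (a + 1)
    | succ b ihb =>
      rw [partialFractionHalf_succ_succ, partialFractionHalf_succ_succ]
      calc U ^ (a + 1 + 1) * V ^ (b + 1 + 1) = (U * V) * (U ^ (a + 1) * V ^ (b + 1)) := by ring
        _ = W * (U ^ (a + 1 + 1) * V ^ (b + 1) + U ^ (a + 1) * V ^ (b + 1 + 1)) := by rw [h]; ring
        _ = _ := by rw [ihb, iha (b + 1)]; ring

theorem partialFractionHalf_eq_sum_Icc (U W : ℝ) {a b : ℕ} (ha : 1 ≤ a) (hb : 1 ≤ b) :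
    partialFractionHalf U W (a - 1) (b - 1) = ∑ m ∈ Finset.Icc 1 a,
      ((a + b - m - 1).choose (b - 1) : ℝ) * (U ^ m * W ^ (a + b - m)) := by
  refine Finset.sum_nbij' (fun i => a - i) (fun m => a - m) ?_ ?_ ?_ ?_ ?_
  · intro i hi; simp only [Finset.mem_range, Finset.mem_Icc] at *; omega
  · intro i hi; simp only [Finset.mem_range, Finset.mem_Icc] at *; omega
  · intro i hi; simp only [Finset.mem_range] at *; omega
  · intro i hi; simp only [Finset.mem_Icc] at *; omega
  · intro i hi
    simp only [Finset.mem_range] at hi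
    rw [show b - 1 + i = a + b - (a - i) - 1 by omega, show a - 1 + 1 - i = a - i by omega,
      show b - 1 + 1 + i = a + b - (a - i) by omega]

theorem one_div_pow_mul_sub_pow {x v : ℝ} (hx : x ≠ 0) (hv : v ≠ 0) (hxv : x - v ≠ 0)
    {a n : ℕ} (ha : 1 ≤ a) (hn : 1 ≤ n) :
    1 / x ^ a * (1 / (x - v) ^ n) =
      (-1) ^ n * ∑ m ∈ Finset.Icc 1 a,
        ((a + n - m - 1).choose (n - 1) : ℝ) * (1 / x ^ m * (1 / v ^ (a + n - m))) +
      ∑ m ∈ Finset.Icc 1 n, (-1) ^ (n + m) * ((a + n - m - 1).choose (a - 1) : ℝ) *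
        (1 / (x - v) ^ m * (1 / v ^ (a + n - m))) := by
  -- The sign on 1 / (x - v) is what gives the relation U * V = W * (U + V), with W = 1 / v; it
  -- accounts for all signs in the expansion.
  have h : (1 / x) * (-(1 / (x - v))) = (1 / v) * (1 / x + -(1 / (x - v))) := by
    field_simp; ring
  have key := mul_pow_eq_partialFractionHalf h (a - 1) (n - 1)
  rw [Nat.sub_add_cancel ha, Nat.sub_add_cancel hn, partialFractionHalf_eq_sum_Icc _ _ ha hn,
    partialFractionHalf_eq_sum_Icc _ _ hn ha] at key
  have hs : ((-1 : ℝ) ^ n) * (-1) ^ n = 1 := by rw [← mul_pow]; norm_num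
  have e : 1 / x ^ a * (1 / (x - v) ^ n) =
      (-1) ^ n * ((1 / x) ^ a * (-(1 / (x - v))) ^ n) := by
    rw [neg_pow (1 / (x - v)), one_div_pow, one_div_pow]
    linear_combination (-(1 / x ^ a * (1 / (x - v) ^ n))) * hs
  rw [e, key, mul_add]
  congr 1
  · simp only [one_div_pow]
  · rw [Finset.mul_sum]
    refine Finset.sum_congr rfl fun m _ => ?_
    rw [neg_pow (1 / (x - v)), one_div_pow, one_div_pow, add_comm n a, pow_add (-1 : ℝ) n m]
    ring

end PartialFractions

/-! ### Exact identities between finite sums -/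

section FiniteIdentities

theorem convSum_comm (n s y : ℕ) : convSum n s y = convSum s n y := by
  refine Finset.sum_nbij' (fun z => y - z) (fun z => y - z) ?_ ?_ ?_ ?_ ?_
  · intro i hi; simp only [Finset.mem_Ico] at *; omega
  · intro i hi; simp only [Finset.mem_Ico] at *; omega
  · intro i hi; simp only [Finset.mem_Ico] at *; omega
  · intro i hi; simp only [Finset.mem_Ico] at *; omega
  · intro i hi
    simp only [Finset.mem_Ico] at hi
    rw [Nat.cast_sub hi.2.le]
    ring

theorem tornheimSum_comm (a n s M : ℕ) : tornheimSum a n s M = tornheimSum a s n M := by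
  simp only [tornheimSum, convSum_comm n s]

/-- The reflection z ↦ y - z, obtained from the symmetry of `convSum` with one exponent equal to 0.
-/
theorem singleSum_eq_sum_sub (c y : ℕ) :
    singleSum c y = ∑ z ∈ Finset.Ico 1 y, 1 / ((y : ℝ) - z) ^ c := by
  have := convSum_comm 0 c y
  simpa [convSum, singleSum] using this

theorem one_div_pow_mul_singleSum (y : ℕ) {b c : ℕ} (hb : 1 ≤ b) (hc : 1 ≤ c) :
    1 / (y : ℝ) ^ b * singleSum c y =
      (-1) ^ c * ∑ n ∈ Finset.Icc 1 b,
        ((b + c - n - 1).choose (c - 1) : ℝ) * (1 / (y : ℝ) ^ n * singleSum (b + c - n) y) +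
      ∑ n ∈ Finset.Icc 1 c, (-1) ^ (c + n) * ((b + c - n - 1).choose (b - 1) : ℝ) *
        convSum n (b + c - n) y := by
  rw [singleSum_eq_sum_sub, Finset.mul_sum]
  have : ∀ z ∈ Finset.Ico 1 y, _ := fun z hz =>
    one_div_pow_mul_sub_pow (x := (y : ℝ)) (v := (z : ℝ)) (a := b) (n := c)
      (by simp only [Finset.mem_Ico] at hz; norm_cast; omega)
      (by simp only [Finset.mem_Ico] at hz; norm_cast; omega)
      (by simp only [Finset.mem_Ico] at hz; rw [sub_ne_zero]; norm_cast; omega) hb hc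
  rw [Finset.sum_congr rfl this, Finset.sum_add_distrib, ← Finset.mul_sum, Finset.sum_comm,
    Finset.sum_comm (s := Finset.Ico 1 y) (t := Finset.Icc 1 c)]
  simp only [singleSum, convSum, Finset.mul_sum]

theorem tripleSum_eq_add_tornheimSum (a M : ℕ) {b c : ℕ} (hb : 1 ≤ b) (hc : 1 ≤ c) :
    tripleSum a b c M =
      (-1) ^ c * ∑ n ∈ Finset.Icc 1 b,
        ((b + c - n - 1).choose (c - 1) : ℝ) * tripleSum a n (b + c - n) M +
      ∑ n ∈ Finset.Icc 1 c, (-1) ^ (c + n) * ((b + c - n - 1).choose (b - 1) : ℝ) *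
        tornheimSum a n (b + c - n) M := by
  have h : ∀ x, doubleSum b c x = (-1) ^ c * ∑ n ∈ Finset.Icc 1 b,
        ((b + c - n - 1).choose (c - 1) : ℝ) * doubleSum n (b + c - n) x +
      ∑ n ∈ Finset.Icc 1 c, (-1) ^ (c + n) * ((b + c - n - 1).choose (b - 1) : ℝ) *
        ∑ y ∈ Finset.Ico 1 x, convSum n (b + c - n) y := by
    intro x
    rw [doubleSum, Finset.sum_congr rfl fun y _ => one_div_pow_mul_singleSum y hb hc,
      Finset.sum_add_distrib, ← Finset.mul_sum, Finset.sum_comm,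
      Finset.sum_comm (s := Finset.Ico 1 x) (t := Finset.Icc 1 c)]
    simp only [doubleSum, Finset.mul_sum]
  simp only [tripleSum, h, tornheimSum, mul_add, Finset.sum_add_distrib]
  congr 1
  · simp only [Finset.mul_sum]
    rw [Finset.sum_comm]
    exact Finset.sum_congr rfl fun _ _ => Finset.sum_congr rfl fun _ _ => by ring
  · simp only [Finset.mul_sum]
    rw [Finset.sum_comm]
    refine Finset.sum_congr rfl fun _ _ => Finset.sum_congr rfl fun _ _ =>
      Finset.sum_congr rfl fun _ _ => by ring

/-- Change of variable v = x - w, which makes x - v a factor that can be expanded against x. -/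
theorem sum_convSum (n s x : ℕ) :
    ∑ y ∈ Finset.Ico 1 x, convSum n s y =
      ∑ v ∈ Finset.Ico 1 x, 1 / ((x : ℝ) - v) ^ n * singleSum s v := by
  simp only [convSum, singleSum, Finset.mul_sum]
  rw [Finset.sum_sigma', Finset.sum_sigma']
  -- With w = y - z, the new variable is v = x + z - y; for fixed z this map is an involution, hence
  -- its own inverse.
  refine Finset.sum_nbij' (fun p => ⟨x + p.2 - p.1, p.2⟩) (fun p => ⟨x + p.2 - p.1, p.2⟩)
    ?_ ?_ ?_ ?_ ?_
  · rintro ⟨y, z⟩ h; simp only [Finset.mem_sigma, Finset.mem_Ico] at *; omega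
  · rintro ⟨y, z⟩ h; simp only [Finset.mem_sigma, Finset.mem_Ico] at *; omega
  · rintro ⟨y, z⟩ h
    simp only [Finset.mem_sigma, Finset.mem_Ico] at *
    rw [show x + z - (x + z - y) = y by omega]
  · rintro ⟨y, z⟩ h
    simp only [Finset.mem_sigma, Finset.mem_Ico] at *
    rw [show x + z - (x + z - y) = y by omega]
  · rintro ⟨y, z⟩ h
    simp only [Finset.mem_sigma, Finset.mem_Ico] at *
    rw [Nat.cast_sub (by omega)]
    push_cast
    ring

theorem tornheimSum_eq (s M : ℕ) {a n : ℕ} (ha : 1 ≤ a) (hn : 1 ≤ n) :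
    tornheimSum a n s M =
      (-1) ^ n * ∑ m ∈ Finset.Icc 1 a,
        ((a + n - m - 1).choose (n - 1) : ℝ) * tripleSum m (a + n - m) s M +
      ∑ m ∈ Finset.Icc 1 n, (-1) ^ (n + m) * ((a + n - m - 1).choose (a - 1) : ℝ) *
        truncProd m (a + n - m) s M := by
  have h : ∀ x : ℕ, ∀ v ∈ Finset.Ico 1 x,
      1 / (x : ℝ) ^ a * (1 / ((x : ℝ) - v) ^ n * singleSum s v) =
      ((-1) ^ n * ∑ m ∈ Finset.Icc 1 a, ((a + n - m - 1).choose (n - 1) : ℝ) *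
        (1 / (x : ℝ) ^ m * (1 / (v : ℝ) ^ (a + n - m))) +
      ∑ m ∈ Finset.Icc 1 n, (-1) ^ (n + m) * ((a + n - m - 1).choose (a - 1) : ℝ) *
        (1 / ((x : ℝ) - v) ^ m * (1 / (v : ℝ) ^ (a + n - m)))) * singleSum s v := by
    intro x z hz
    rw [← mul_assoc, one_div_pow_mul_sub_pow (x := (x : ℝ)) (v := (z : ℝ)) (a := a) (n := n)
      (by simp only [Finset.mem_Ico] at hz; norm_cast; omega)
      (by simp only [Finset.mem_Ico] at hz; norm_cast; omega)
      (by simp only [Finset.mem_Ico] at hz; rw [sub_ne_zero]; norm_cast; omega) ha hn]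
  have h2 : tornheimSum a n s M = ∑ x ∈ Finset.Ico 1 M, ∑ v ∈ Finset.Ico 1 x,
      1 / (x : ℝ) ^ a * (1 / ((x : ℝ) - v) ^ n * singleSum s v) := by
    simp only [tornheimSum, sum_convSum, Finset.mul_sum]
  rw [h2, Finset.sum_congr rfl fun x _ => Finset.sum_congr rfl (h x)]
  simp only [add_mul, Finset.sum_add_distrib]
  congr 1
  · simp only [tripleSum, doubleSum, Finset.mul_sum, Finset.sum_mul]
    rw [Finset.sum_comm]
    conv_rhs => rw [Finset.sum_comm]
    rw [Finset.sum_comm]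
    refine Finset.sum_congr rfl fun x _ => ?_
    rw [Finset.sum_comm]
    exact Finset.sum_congr rfl fun _ _ => Finset.sum_congr rfl fun _ _ => by ring
  · simp only [truncProd, Finset.mul_sum, Finset.sum_mul]
    conv_rhs => rw [Finset.sum_comm]
    refine Finset.sum_congr rfl fun x _ => ?_
    rw [Finset.sum_comm]
    exact Finset.sum_congr rfl fun _ _ => Finset.sum_congr rfl fun _ _ => by ring

theorem singleSum_succ (p : ℕ) {M : ℕ} (hM : 1 ≤ M) :
    singleSum p (M + 1) = singleSum p M + 1 / (M : ℝ) ^ p :=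
  Finset.sum_Ico_succ_top hM _

theorem doubleSum_succ (p q : ℕ) {M : ℕ} (hM : 1 ≤ M) :
    doubleSum p q (M + 1) = doubleSum p q M + 1 / (M : ℝ) ^ p * singleSum q M :=
  Finset.sum_Ico_succ_top hM _

theorem tripleSum_succ (p q r : ℕ) {M : ℕ} (hM : 1 ≤ M) :
    tripleSum p q r (M + 1) = tripleSum p q r M + 1 / (M : ℝ) ^ p * doubleSum q r M :=
  Finset.sum_Ico_succ_top hM _

theorem singleSum_mul_singleSum (p q N : ℕ) :
    singleSum p (N + 1) * singleSum q (N + 1) =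
      doubleSum p q (N + 1) + doubleSum q p (N + 1) + singleSum (p + q) (N + 1) := by
  induction N with
  | zero => simp [singleSum, doubleSum]
  | succ N ih =>
    have h : 1 ≤ N + 1 := by omega
    rw [singleSum_succ p h, singleSum_succ q h, singleSum_succ (p + q) h, doubleSum_succ p q h,
      doubleSum_succ q p h, pow_add, ← one_div_mul_one_div]
    linear_combination ih

/-- The stuffle product: the free index lies above, between or below the other two, or coincides
with one of them. The cutoff N + 1 keeps the range nonempty enough to peel off its top term. -/
theorem singleSum_mul_doubleSum (k p q N : ℕ) :
    singleSum k (N + 1) * doubleSum p q (N + 1) =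
      tripleSum k p q (N + 1) + tripleSum p k q (N + 1) + tripleSum p q k (N + 1) +
      doubleSum (k + p) q (N + 1) + doubleSum p (k + q) (N + 1) := by
  induction N with
  | zero => simp [singleSum, doubleSum, tripleSum]
  | succ N ih =>
    have h : 1 ≤ N + 1 := by omega
    rw [singleSum_succ k h, doubleSum_succ p q h, doubleSum_succ (k + p) q h,
      doubleSum_succ p (k + q) h, tripleSum_succ k p q h, tripleSum_succ p k q h,
      tripleSum_succ p q k h, pow_add _ k p, ← one_div_mul_one_div]
    -- Among the new top terms, those in which the double sum supplies the top index contain a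
    -- product of two single sums, handled by the shorter stuffle product.
    linear_combination ih + 1 / ((N + 1 : ℕ) : ℝ) ^ p * singleSum_mul_singleSum k q N

end FiniteIdentities

/-! ### Growth bounds and the error from the truncated product -/

section Asymptotics

theorem singleSum_nonneg (p M : ℕ) : 0 ≤ singleSum p M :=
  Finset.sum_nonneg fun _ _ => by positivity

theorem doubleSum_nonneg (p q M : ℕ) : 0 ≤ doubleSum p q M :=
  Finset.sum_nonneg fun _ _ => mul_nonneg (by positivity) (singleSum_nonneg _ _)

theorem one_div_natCast_pow_le {x k l : ℕ} (hx : 1 ≤ x) (h : k ≤ l) :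
    1 / (x : ℝ) ^ l ≤ 1 / (x : ℝ) ^ k :=
  one_div_le_one_div_of_le (by positivity) (pow_le_pow_right₀ (by exact_mod_cast hx) h)

theorem singleSum_le_singleSum_one {p x M : ℕ} (hp : 1 ≤ p) (hx : x ≤ M) :
    singleSum p x ≤ singleSum 1 M := by
  calc singleSum p x ≤ singleSum 1 x :=
        Finset.sum_le_sum fun y hy => one_div_natCast_pow_le (Finset.mem_Ico.1 hy).1 hp
    _ ≤ singleSum 1 M := Finset.sum_le_sum_of_subset_of_nonneg (Finset.Ico_subset_Ico_right hx)
        fun _ _ _ => by positivity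

theorem doubleSum_le_sq {p q M : ℕ} (hp : 1 ≤ p) (hq : 1 ≤ q) :
    doubleSum p q M ≤ singleSum 1 M ^ 2 := by
  calc doubleSum p q M ≤ ∑ x ∈ Finset.Ico 1 M, 1 / (x : ℝ) ^ 1 * singleSum 1 M := by
        refine Finset.sum_le_sum fun x hx => ?_
        rw [Finset.mem_Ico] at hx
        exact mul_le_mul (one_div_natCast_pow_le hx.1 hp) (singleSum_le_singleSum_one hq hx.2.le)
          (singleSum_nonneg _ _) (by positivity)
    _ = singleSum 1 M ^ 2 := by rw [← Finset.sum_mul, sq]; rfl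

theorem singleSum_one_succ_eq_harmonic (N : ℕ) : singleSum 1 (N + 1) = (harmonic N : ℝ) := by
  induction N with
  | zero => simp [singleSum]
  | succ N ih => rw [singleSum_succ 1 (by omega), ih, harmonic_succ]; push_cast; simp

/-- From 1 + log M ≤ 1 + 4 M^(1/4). The exponent 1/4 is chosen so that the square grows like
M^(1/2): this leaves x^(-3/2) in the convergence proofs and M^(-1/2) in the error term. -/
theorem singleSum_one_le_rpow {M : ℕ} (hM : 1 ≤ M) : singleSum 1 M ≤ 5 * (M : ℝ) ^ (1 / 4 : ℝ) := by
  have hM' : (1 : ℝ) ≤ M := by exact_mod_cast hM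
  have h1 : singleSum 1 M ≤ 1 + Real.log M := by
    refine (singleSum_le_singleSum_one le_rfl (Nat.le_succ M)).trans ?_
    rw [singleSum_one_succ_eq_harmonic]
    exact harmonic_le_one_add_log M
  have h2 := Real.log_le_rpow_div (x := (M : ℝ)) (by positivity) (show (0 : ℝ) < 1 / 4 by norm_num)
  have h3 := Real.one_le_rpow hM' (show (0 : ℝ) ≤ 1 / 4 by norm_num)
  linarith

theorem singleSum_one_sq_le {M : ℕ} (hM : 1 ≤ M) :
    singleSum 1 M ^ 2 ≤ 25 * (M : ℝ) ^ (1 / 2 : ℝ) := by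
  calc singleSum 1 M ^ 2 ≤ (5 * (M : ℝ) ^ (1 / 4 : ℝ)) ^ 2 :=
        pow_le_pow_left₀ (singleSum_nonneg _ _) (singleSum_one_le_rpow hM) 2
    _ = 25 * (M : ℝ) ^ (1 / 2 : ℝ) := by
        rw [mul_pow, ← Real.rpow_natCast ((M : ℝ) ^ (1 / 4 : ℝ)), ← Real.rpow_mul (by positivity)]
        norm_num

theorem exists_sum_one_div_pow_mul_le (C : ℝ) {g : ℕ → ℝ} {p : ℕ} (hp : 2 ≤ p)
    (hg0 : ∀ x, 0 ≤ g x) (hg : ∀ x, 1 ≤ x → g x ≤ C * (x : ℝ) ^ (1 / 2 : ℝ)) :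
    ∃ B, ∀ M : ℕ, ∑ x ∈ Finset.Ico 1 M, 1 / (x : ℝ) ^ p * g x ≤ B := by
  have hs : Summable fun x : ℕ => C * (1 / (x : ℝ) ^ (3 / 2 : ℝ)) :=
    (Real.summable_one_div_nat_rpow.2 (by norm_num)).mul_left C
  have hC : 0 ≤ C := by simpa using (hg0 1).trans (hg 1 le_rfl)
  refine ⟨_, fun M => le_trans (Finset.sum_le_sum fun x hx => ?_)
    (hs.sum_le_tsum (Finset.Ico 1 M) fun x _ => by positivity)⟩
  have hx1 := (Finset.mem_Ico.1 hx).1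
  have hx0 : (0 : ℝ) < x := by exact_mod_cast hx1
  calc 1 / (x : ℝ) ^ p * g x ≤ 1 / (x : ℝ) ^ 2 * (C * (x : ℝ) ^ (1 / 2 : ℝ)) :=
        mul_le_mul (one_div_natCast_pow_le hx1 hp) (hg x hx1) (hg0 x) (by positivity)
    _ = C * (1 / (x : ℝ) ^ (3 / 2 : ℝ)) := by
        have : (x : ℝ) ^ 2 = (x : ℝ) ^ (3 / 2 : ℝ) * (x : ℝ) ^ (1 / 2 : ℝ) := by
          rw [← Real.rpow_add hx0]; norm_num
        rw [this]; field_simp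

theorem exists_singleSum_le {p : ℕ} (hp : 2 ≤ p) : ∃ B, ∀ M, singleSum p M ≤ B := by
  obtain ⟨B, hB⟩ := exists_sum_one_div_pow_mul_le 1 (g := fun _ => 1) hp (fun _ => zero_le_one)
    (fun x hx => by
      rw [one_mul]; exact Real.one_le_rpow (by exact_mod_cast hx) (by norm_num))
  exact ⟨B, fun M => by simpa [singleSum] using hB M⟩

theorem exists_doubleSum_le {p q : ℕ} (hp : 2 ≤ p) (hq : 1 ≤ q) : ∃ B, ∀ M, doubleSum p q M ≤ B := by
  refine exists_sum_one_div_pow_mul_le 5 hp (singleSum_nonneg q) fun x hx =>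
    (singleSum_le_singleSum_one hq le_rfl).trans ((singleSum_one_le_rpow hx).trans ?_)
  gcongr
  · exact_mod_cast hx
  · norm_num

theorem exists_tripleSum_le {p q r : ℕ} (hp : 2 ≤ p) (hq : 1 ≤ q) (hr : 1 ≤ r) :
    ∃ B, ∀ M, tripleSum p q r M ≤ B :=
  exists_sum_one_div_pow_mul_le 25 hp (doubleSum_nonneg q r) fun _ hx =>
    (doubleSum_le_sq hq hr).trans (singleSum_one_sq_le hx)

/-- For fixed v, the variable w = x - v runs freely below M - v; comparison with the full product
thus reduces to tails of single sums. -/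
theorem truncProd_eq_sum (m p s M : ℕ) :
    truncProd m p s M =
      ∑ v ∈ Finset.Ico 1 M, 1 / (v : ℝ) ^ p * singleSum s v * singleSum m (M - v) := by
  have h : ∀ v : ℕ, 1 / (v : ℝ) ^ p * singleSum s v * singleSum m (M - v) =
      ∑ w ∈ Finset.Ico 1 (M - v), 1 / (w : ℝ) ^ m * (1 / (v : ℝ) ^ p * singleSum s v) := by
    intro v
    rw [← Finset.sum_mul, mul_comm]; rfl
  simp only [truncProd, h]
  rw [Finset.sum_sigma', Finset.sum_sigma']
  refine Finset.sum_nbij' (fun t => ⟨t.2, t.1 - t.2⟩) (fun t => ⟨t.1 + t.2, t.1⟩) ?_ ?_ ?_ ?_ ?_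
  · rintro ⟨x, v⟩ h; simp only [Finset.mem_sigma, Finset.mem_Ico] at *; omega
  · rintro ⟨x, v⟩ h; simp only [Finset.mem_sigma, Finset.mem_Ico] at *; omega
  · rintro ⟨x, v⟩ h
    simp only [Finset.mem_sigma, Finset.mem_Ico] at *
    rw [show v + (x - v) = x by omega]
  · rintro ⟨x, v⟩ h
    simp only [Finset.mem_sigma, Finset.mem_Ico] at *
    rw [show x + v - x = v by omega]
  · rintro ⟨x, v⟩ h
    simp only [Finset.mem_sigma, Finset.mem_Ico] at *
    rw [Nat.cast_sub (by omega)]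

theorem singleSum_sub_singleSum_sub_mem {m v M : ℕ} (hm : 1 ≤ m) (hv : v < M) :
    0 ≤ singleSum m M - singleSum m (M - v) ∧
      singleSum m M - singleSum m (M - v) ≤ v * (1 / ((M : ℝ) - v)) := by
  have h : singleSum m M - singleSum m (M - v) = ∑ w ∈ Finset.Ico (M - v) M, 1 / (w : ℝ) ^ m := by
    rw [singleSum, singleSum,
      ← Finset.sum_Ico_consecutive _ (show 1 ≤ M - v by omega) (Nat.sub_le M v)]
    ring
  rw [h]
  refine ⟨Finset.sum_nonneg fun _ _ => by positivity, ?_⟩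
  refine (Finset.sum_le_card_nsmul _ _ (1 / ((M : ℝ) - v)) fun w hw => ?_).trans ?_
  · rw [Finset.mem_Ico] at hw
    have h1 : ((M - v : ℕ) : ℝ) ≤ w := by exact_mod_cast hw.1
    rw [Nat.cast_sub hv.le] at h1
    have h2 : (0 : ℝ) < M - v := by rw [sub_pos]; exact_mod_cast hv
    refine (one_div_natCast_pow_le (by omega) hm).trans ?_
    rw [pow_one]
    exact one_div_le_one_div_of_le h2 h1
  · rw [Nat.card_Ico, nsmul_eq_mul, show M - (M - v) = v by omega]

/-- The tail of v terms costs at most v / (M - v). Since p ≥ 2, one factor v is absorbed, leaving a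
multiple of 1 / (v (M - v)), whose sum is small. -/
theorem singleSum_mul_doubleSum_sub_truncProd_mem {m p s M : ℕ} (hm : 1 ≤ m) (hp : 2 ≤ p)
    (hs : 1 ≤ s) (hM : 1 ≤ M) :
    0 ≤ singleSum m M * doubleSum p s M - truncProd m p s M ∧
      singleSum m M * doubleSum p s M - truncProd m p s M ≤ 2 * singleSum 1 M ^ 2 / M := by
  have h : singleSum m M * doubleSum p s M - truncProd m p s M =
      ∑ v ∈ Finset.Ico 1 M, 1 / (v : ℝ) ^ p * singleSum s v *
        (singleSum m M - singleSum m (M - v)) := by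
    rw [truncProd_eq_sum, doubleSum, Finset.mul_sum, ← Finset.sum_sub_distrib]
    exact Finset.sum_congr rfl fun _ _ => by ring
  rw [h]
  constructor
  · refine Finset.sum_nonneg fun v hv => mul_nonneg (mul_nonneg (by positivity)
      (singleSum_nonneg _ _)) (singleSum_sub_singleSum_sub_mem hm (Finset.mem_Ico.1 hv).2).1
  · have hM0 : (0 : ℝ) < M := by exact_mod_cast hM
    have hr : ∑ v ∈ Finset.Ico 1 M, 1 / ((M : ℝ) - v) = singleSum 1 M := by
      rw [singleSum_eq_sum_sub]; simp
    -- Uses 1 / (v (M - v)) = (1 / v + 1 / (M - v)) / M; both parts sum to the same harmonic sum.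
    calc _ ≤ ∑ v ∈ Finset.Ico 1 M, singleSum 1 M / M * (1 / (v : ℝ) ^ 1 + 1 / ((M : ℝ) - v)) := by
          refine Finset.sum_le_sum fun v hv => ?_
          rw [Finset.mem_Ico] at hv
          have hv0 : (0 : ℝ) < v := by exact_mod_cast hv.1
          have h2 : (0 : ℝ) < M - v := by rw [sub_pos]; exact_mod_cast hv.2
          obtain ⟨h3, h4⟩ := singleSum_sub_singleSum_sub_mem hm hv.2
          calc _ ≤ 1 / (v : ℝ) ^ 2 * singleSum 1 M * (v * (1 / ((M : ℝ) - v))) := by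
                refine mul_le_mul (mul_le_mul (one_div_natCast_pow_le hv.1 hp)
                  (singleSum_le_singleSum_one hs hv.2.le) (singleSum_nonneg _ _) (by positivity))
                  h4 h3 (mul_nonneg (by positivity) (singleSum_nonneg _ _))
            _ = _ := by field_simp; ring
      _ = 2 * singleSum 1 M ^ 2 / M := by
          rw [← Finset.mul_sum, Finset.sum_add_distrib, hr, ← singleSum]; ring

theorem tendsto_singleSum_mul_doubleSum_sub_truncProd {m p s : ℕ} (hm : 1 ≤ m) (hp : 2 ≤ p)
    (hs : 1 ≤ s) :
    Tendsto (fun N : ℕ => singleSum m (N + 1) * doubleSum p s (N + 1) - truncProd m p s (N + 1))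
      atTop (𝓝 0) := by
  have h0 : Tendsto (fun N : ℕ => 50 * (((N + 1 : ℕ) : ℝ) ^ (-(1 / 2) : ℝ))) atTop (𝓝 0) := by
    have h := (tendsto_rpow_neg_atTop (show (0 : ℝ) < 1 / 2 by norm_num)).comp
      (tendsto_natCast_atTop_atTop.comp (tendsto_add_atTop_nat 1))
    simpa using h.const_mul 50
  refine squeeze_zero (fun N => (singleSum_mul_doubleSum_sub_truncProd_mem hm hp hs
    (Nat.succ_pos N)).1) (fun N => ?_) h0
  refine (singleSum_mul_doubleSum_sub_truncProd_mem hm hp hs (Nat.succ_pos N)).2.trans ?_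
  have hN : (0 : ℝ) < ((N + 1 : ℕ) : ℝ) := by positivity
  have h1 : ((N + 1 : ℕ) : ℝ) ^ (-(1 / 2) : ℝ) * ((N + 1 : ℕ) : ℝ) =
      ((N + 1 : ℕ) : ℝ) ^ (1 / 2 : ℝ) := by
    rw [← Real.rpow_add_one hN.ne']; norm_num
  rw [div_le_iff₀ hN, mul_assoc, h1]
  linarith [singleSum_one_sq_le (Nat.succ_pos N)]

end Asymptotics

/-! ### Convergence, and truncated zeta values as iterated sums -/

section MultipleZeta

theorem mzvTerm_nonneg {m : ℕ} (k n : Fin m → ℕ) : 0 ≤ mzvTerm k n :=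
  Finset.prod_nonneg fun _ _ => by positivity

open Classical in
/-- The indices of the truncated sum `mzvTrunc N`. -/
noncomputable def truncIndex (m N : ℕ) : Finset (MZVIndex m) :=
  Finset.subtype (fun n : Fin m → ℕ => StrictAnti n ∧ ∀ i, 0 < n i)
    ((Fintype.piFinset fun _ : Fin m => Finset.Icc 1 N).filter StrictAnti)

theorem mem_truncIndex {m N : ℕ} {n : MZVIndex m} : n ∈ truncIndex m N ↔ ∀ i, n.1 i ≤ N := by
  classical
  have h2 : ∀ i, 1 ≤ n.1 i := n.2.2
  have h1 : StrictAnti n.1 := n.2.1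
  refine Finset.mem_subtype.trans ?_
  simp [h1, h2]

theorem mzvTrunc_eq_sum_truncIndex (N : ℕ) {m : ℕ} (k : Fin m → ℕ) :
    mzvTrunc N k = ∑ n ∈ truncIndex m N, mzvTerm k n.1 := by
  classical
  refine (Finset.sum_subtype_of_mem (mzvTerm k) fun n hn => ?_).symm
  simp only [Finset.mem_filter, Fintype.mem_piFinset, Finset.mem_Icc] at hn
  exact ⟨hn.2, fun i => (hn.1 i).1⟩

/-- The truncations exhaust the index set, so an unconditional sum is the limit of its truncations,
and bounded truncations give summability. -/
theorem tendsto_truncIndex (m : ℕ) : Tendsto (truncIndex m) atTop atTop := by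
  refine tendsto_atTop_finset_of_monotone (fun M N h n hn => ?_) fun n => ?_
  · rw [mem_truncIndex] at *
    exact fun i => (hn i).trans h
  -- The sum of the entries is a convenient cutoff bounding each of them.
  · exact ⟨∑ i, n.1 i, mem_truncIndex.2 fun i =>
      Finset.single_le_sum (fun _ _ => Nat.zero_le _) (Finset.mem_univ i)⟩

theorem mzvConverges_of_mzvTrunc_le {m : ℕ} {k : Fin m → ℕ} (h : ∃ B, ∀ N, mzvTrunc N k ≤ B) :
    MZVConverges k := by
  obtain ⟨B, hB⟩ := h
  refine summable_of_sum_le (c := B) (fun n => mzvTerm_nonneg k n.1) fun u => ?_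
  obtain ⟨N, hN⟩ := ((tendsto_truncIndex m).eventually_ge_atTop u).exists
  refine (Finset.sum_le_sum_of_subset_of_nonneg hN fun n _ _ => mzvTerm_nonneg k n.1).trans ?_
  rw [← mzvTrunc_eq_sum_truncIndex]
  exact hB N

theorem MZVConverges.tendsto {m : ℕ} {k : Fin m → ℕ} (h : MZVConverges k) :
    Tendsto (fun N => mzvTrunc N k) atTop (𝓝 (mzv k)) := by
  simp only [mzvTrunc_eq_sum_truncIndex]
  exact h.hasSum.comp (tendsto_truncIndex m)

theorem mzvTrunc_one (N p : ℕ) : mzvTrunc N ![p] = singleSum p (N + 1) := by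
  classical
  unfold mzvTrunc singleSum
  refine Finset.sum_nbij' (fun n => n 0) (fun x => ![x]) ?_ ?_ ?_ ?_ ?_
  · intro n hn
    simp only [Finset.mem_filter, Fintype.mem_piFinset, Finset.mem_Icc, Finset.mem_Ico] at *
    have := hn.1 0; omega
  · intro x hx
    simp only [Finset.mem_filter, Fintype.mem_piFinset, Finset.mem_Icc, Finset.mem_Ico] at *
    refine ⟨fun i => ?_, Subsingleton.strictAnti _⟩
    fin_cases i; simp; omega
  · intro n _; ext i; fin_cases i; rfl
  · intro x _; rfl
  · intro n _; simp [mzvTerm]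

theorem mzvTrunc_two (N p q : ℕ) : mzvTrunc N ![p, q] = doubleSum p q (N + 1) := by
  classical
  simp only [mzvTrunc, doubleSum, singleSum, Finset.mul_sum]
  rw [Finset.sum_sigma']
  refine Finset.sum_nbij' (fun n => ⟨n 0, n 1⟩) (fun x => ![x.1, x.2]) ?_ ?_ ?_ ?_ ?_
  · intro n hn
    simp only [Finset.mem_filter, Fintype.mem_piFinset, Finset.mem_Icc, Finset.mem_Ico,
      Finset.mem_sigma] at *
    have h0 := hn.1 0
    have h1 := hn.1 1
    have h2 := hn.2 (show (0 : Fin 2) < 1 by decide)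
    omega
  · rintro ⟨x, y⟩ hx
    simp only [Finset.mem_filter, Fintype.mem_piFinset, Finset.mem_Icc, Finset.mem_Ico,
      Finset.mem_sigma] at *
    refine ⟨fun i => ?_, Fin.strictAnti_iff_succ_lt.2 fun i => ?_⟩
    · fin_cases i <;> simp <;> omega
    · fin_cases i; simp; omega
  · intro n _; ext i; fin_cases i <;> rfl
  · intro x _; rfl
  · intro n _; simp [mzvTerm, Fin.prod_univ_two, mul_comm]

theorem mzvTrunc_three (N p q r : ℕ) : mzvTrunc N ![p, q, r] = tripleSum p q r (N + 1) := by
  classical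
  simp only [mzvTrunc, tripleSum, doubleSum, singleSum, Finset.mul_sum]
  rw [Finset.sum_congr rfl fun x _ => Finset.sum_sigma' _ _ _, Finset.sum_sigma']
  refine Finset.sum_nbij' (fun n => ⟨n 0, n 1, n 2⟩) (fun x => ![x.1, x.2.1, x.2.2]) ?_ ?_ ?_ ?_ ?_
  · intro n hn
    simp only [Finset.mem_filter, Fintype.mem_piFinset, Finset.mem_Icc, Finset.mem_Ico,
      Finset.mem_sigma] at *
    have h0 := hn.1 0
    have h1 := hn.1 1
    have h2 := hn.1 2
    have h3 := hn.2 (show (0 : Fin 3) < 1 by decide)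
    have h4 := hn.2 (show (1 : Fin 3) < 2 by decide)
    omega
  · rintro ⟨x, y, z⟩ hx
    simp only [Finset.mem_filter, Fintype.mem_piFinset, Finset.mem_Icc, Finset.mem_Ico,
      Finset.mem_sigma] at *
    refine ⟨fun i => ?_, Fin.strictAnti_iff_succ_lt.2 fun i => ?_⟩
    · fin_cases i <;> simp <;> omega
    · fin_cases i <;> simp <;> omega
  · intro n _; ext i; fin_cases i <;> rfl
  · intro x _; rfl
  · intro n _; simp only [mzvTerm, Fin.prod_univ_three, Matrix.cons_val]; ring

theorem mzvConverges_one {p : ℕ} (hp : 2 ≤ p) : MZVConverges ![p] :=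
  mzvConverges_of_mzvTrunc_le <| (exists_singleSum_le hp).imp fun _ h N =>
    (mzvTrunc_one N p).trans_le (h _)

theorem mzvConverges_two {p q : ℕ} (hp : 2 ≤ p) (hq : 1 ≤ q) : MZVConverges ![p, q] :=
  mzvConverges_of_mzvTrunc_le <| (exists_doubleSum_le hp hq).imp fun _ h N =>
    (mzvTrunc_two N p q).trans_le (h _)

theorem mzvConverges_three {p q r : ℕ} (hp : 2 ≤ p) (hq : 1 ≤ q) (hr : 1 ≤ r) :
    MZVConverges ![p, q, r] :=
  mzvConverges_of_mzvTrunc_le <| (exists_tripleSum_le hp hq hr).imp fun _ h N =>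
    (mzvTrunc_three N p q r).trans_le (h _)

theorem tendsto_mzvTrunc_one_mul_sub {p q : ℕ} (hp : 2 ≤ p) (hq : 1 ≤ q) :
    Tendsto (fun N : ℕ => mzvTrunc N ![1] * mzvTrunc N ![p, q] - mzvTrunc N ![1, p, q]) atTop
      (𝓝 (mzv ![p, q, 1] + mzv ![p, 1, q] + mzv ![p + 1, q] + mzv ![p, q + 1])) := by
  have h : ∀ N : ℕ, mzvTrunc N ![1] * mzvTrunc N ![p, q] - mzvTrunc N ![1, p, q] =
      mzvTrunc N ![p, q, 1] + mzvTrunc N ![p, 1, q] + mzvTrunc N ![p + 1, q] +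
        mzvTrunc N ![p, q + 1] := by
    intro N
    simp only [mzvTrunc_one, mzvTrunc_two, mzvTrunc_three]
    rw [singleSum_mul_doubleSum, add_comm 1 p, add_comm 1 q]
    ring
  simp only [h]
  exact (((mzvConverges_three hp hq le_rfl).tendsto.add
    (mzvConverges_three hp le_rfl hq).tendsto).add
    (mzvConverges_two (by omega) hq).tendsto).add (mzvConverges_two hp (by omega)).tendsto

theorem tendsto_mzvTrunc_mul_sub_truncProd {m p s : ℕ} (hm : 1 ≤ m) (hp : 2 ≤ p) (hs : 1 ≤ s) :
    Tendsto (fun N : ℕ => mzvTrunc N ![m] * mzvTrunc N ![p, s] - truncProd m p s (N + 1))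
      atTop (𝓝 0) := by
  simp only [mzvTrunc_one, mzvTrunc_two]
  exact tendsto_singleSum_mul_doubleSum_sub_truncProd hm hp hs

end MultipleZeta

/-! ### The decompositions at finite cutoff and in the limit -/

section Decomposition

/-- In this grouping the factors are the binomial coefficients produced by the two successive
expansions. -/
theorem trinomial_eq_choose_mul_choose (i j l : ℕ) :
    trinomial i j l = (i + l).choose i * (i + j + l).choose (i + l) := by
  have h1 := Nat.add_choose_mul_factorial_mul_factorial i l
  have h2 := Nat.add_choose_mul_factorial_mul_factorial (i + l) j
  have h3 := Nat.multinomial_spec Finset.univ ![i, j, l]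
  simp only [Fin.sum_univ_three, Fin.prod_univ_three, Matrix.cons_val] at h3
  rw [show i + l + j = i + j + l by ring] at h2
  have hpos : 0 < i.factorial * j.factorial * l.factorial := by positivity
  refine Nat.eq_of_mul_eq_mul_left hpos ?_
  rw [trinomial, h3, ← h2, ← h1, Nat.choose_symm_add,
    Nat.choose_symm_of_eq_add (show i + j + l = (i + l) + j by ring)]
  ring

theorem neg_one_pow_sub_eq_add {c m : ℕ} (h : m ≤ c) : (-1 : ℝ) ^ (c - m) = (-1) ^ (c + m) := by
  obtain ⟨k, rfl⟩ := Nat.exists_eq_add_of_le h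
  rw [show m + k - m = k by omega, show m + k + m = k + 2 * m by ring, pow_add, pow_mul]
  norm_num

theorem neg_one_pow_add_self_mul (c n : ℕ) : (-1 : ℝ) ^ (c + n) * (-1) ^ n = (-1) ^ c := by
  rw [← pow_add, show c + n + n = c + 2 * n by ring, pow_add, pow_mul]
  norm_num

theorem tripleSum_decomposition (M : ℕ) {a b c : ℕ} (ha : 1 ≤ a) (hb : 1 ≤ b) (hc : 1 ≤ c) :
    tripleSum a b c M =
      (-1 : ℝ) ^ c * ∑ n ∈ Finset.Icc 1 b,
          ((b + c - n - 1).choose (c - 1) : ℝ) * tripleSum a n (b + c - n) M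
      + (-1 : ℝ) ^ c * ∑ n ∈ Finset.Icc 1 c, ∑ m ∈ Finset.Icc 1 a,
          ((b + c - n - 1).choose (b - 1) : ℝ) * ((a + n - m - 1).choose (n - 1) : ℝ)
            * tripleSum m (a + n - m) (b + c - n) M
      + ∑ n ∈ Finset.Icc 1 c, ∑ m ∈ Finset.Icc 1 n,
          (-1 : ℝ) ^ (c - m) * ((a + n - m - 1).choose (a - 1) : ℝ)
            * ((b + c - n - 1).choose (b - 1) : ℝ)
            * truncProd m (a + n - m) (b + c - n) M := by
  rw [tripleSum_eq_add_tornheimSum a M hb hc, add_assoc]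
  congr 1
  rw [Finset.mul_sum, ← Finset.sum_add_distrib]
  refine Finset.sum_congr rfl fun n hn => ?_
  rw [Finset.mem_Icc] at hn
  rw [tornheimSum_eq _ _ ha hn.1, mul_add]
  congr 1
  · simp only [Finset.mul_sum]
    refine Finset.sum_congr rfl fun m _ => ?_
    rw [← neg_one_pow_add_self_mul c n]
    ring
  · simp only [Finset.mul_sum]
    refine Finset.sum_congr rfl fun m hm => ?_
    rw [Finset.mem_Icc] at hm
    rw [neg_one_pow_sub_eq_add (hm.2.trans hn.2), pow_add (-1 : ℝ) c m,
      ← neg_one_pow_add_self_mul c n]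
    ring

theorem tripleSum_decomposition' (M : ℕ) {a b c : ℕ} (ha : 1 ≤ a) (hb : 1 ≤ b) (hc : 1 ≤ c) :
    tripleSum a b c M =
      (-1 : ℝ) ^ b * ∑ n ∈ Finset.Icc 1 c,
          ((∑ m ∈ Finset.Icc 1 a,
              (trinomial (b - 1) (a - m) (c - n) : ℝ) * tripleSum m (a + b + c - m - n) n M)
          + ∑ m ∈ Finset.Icc 1 (b + c - n),
              (-1 : ℝ) ^ m * ((b + c - n - 1).choose (b - 1) : ℝ)
                * ((a + b + c - m - n - 1).choose (a - 1) : ℝ)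
                * truncProd m (a + b + c - m - n) n M)
      + ∑ n ∈ Finset.Icc 1 b,
          (-1 : ℝ) ^ c * ((b + c - n - 1).choose (c - 1) : ℝ) * tripleSum a n (b + c - n) M := by
  rw [tripleSum_eq_add_tornheimSum a M hb hc, add_comm]
  congr 1
  · rw [Finset.mul_sum]
    refine Finset.sum_congr rfl fun n hn => ?_
    rw [Finset.mem_Icc] at hn
    have hs : (-1 : ℝ) ^ (c + n) * (-1) ^ (b + c - n) = (-1) ^ b := by
      rw [← pow_add, show c + n + (b + c - n) = b + 2 * c by omega, pow_add, pow_mul]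
      norm_num
    -- The interchange makes b + c - n the exponent that is expanded against a, and leaves n on the
    -- last variable.
    rw [tornheimSum_comm, tornheimSum_eq _ _ ha (show 1 ≤ b + c - n by omega), mul_add, mul_add]
    congr 1
    · simp only [Finset.mul_sum]
      refine Finset.sum_congr rfl fun m hm => ?_
      rw [Finset.mem_Icc] at hm
      rw [trinomial_eq_choose_mul_choose, ← hs, show b - 1 + (c - n) = b + c - n - 1 by omega,
        show b - 1 + (a - m) + (c - n) = a + (b + c - n) - m - 1 by omega,
        show a + b + c - m - n = a + (b + c - n) - m by omega]
      push_cast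
      ring
    · simp only [Finset.mul_sum]
      refine Finset.sum_congr rfl fun m hm => ?_
      rw [Finset.mem_Icc] at hm
      rw [← hs, pow_add (-1 : ℝ) (b + c - n) m,
        show a + b + c - m - n = a + (b + c - n) - m by omega]
      ring
  · rw [Finset.mul_sum]
    exact Finset.sum_congr rfl fun _ _ => by ring

/-- Applied with e the difference between a full product and its `truncProd`: adding these null
sequences turns the finite identity into one with genuine products. -/
theorem tendsto_add_sum_mul_of_tendsto_zero {ι : Type*} {s : Finset ι} {t : ι → Finset ℕ}
    {f : ℕ → ℝ} {l : ℝ} (hf : Tendsto f atTop (𝓝 l)) (c : ι → ℕ → ℝ) {e : ι → ℕ → ℕ → ℝ}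
    (he : ∀ i ∈ s, ∀ j ∈ t i, Tendsto (e i j) atTop (𝓝 0)) :
    Tendsto (fun N => f N + ∑ i ∈ s, ∑ j ∈ t i, c i j * e i j N) atTop (𝓝 l) := by
  have : Tendsto (fun N => f N + ∑ i ∈ s, ∑ j ∈ t i, c i j * e i j N) atTop
      (𝓝 (l + ∑ i ∈ s, ∑ j ∈ t i, c i j * 0)) :=
    hf.add (tendsto_finsetSum _ fun i hi => tendsto_finsetSum _ fun j hj =>
      (he i hi j hj).const_mul _)
  simpa using this

theorem sum_Icc_one_eq_add {n : ℕ} (hn : 1 ≤ n) (f : ℕ → ℝ) :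
    ∑ m ∈ Finset.Icc 1 n, f m = f 1 + ∑ m ∈ Finset.Icc 2 n, f m :=
  (Finset.add_sum_Ioc_eq_sum_Icc hn).symm

theorem tendsto_decomposition {a b c : ℕ} (ha : 2 ≤ a) (hb : 1 ≤ b) (hc : 1 ≤ c) :
    Tendsto (fun N : ℕ =>
        (-1 : ℝ) ^ c * ∑ n ∈ Finset.Icc 1 b,
            ((b + c - n - 1).choose (c - 1) : ℝ) * mzvTrunc N ![a, n, b + c - n]
        + (-1 : ℝ) ^ c * ∑ n ∈ Finset.Icc 1 c, ∑ m ∈ Finset.Icc 1 a,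
            ((b + c - n - 1).choose (b - 1) : ℝ) * ((a + n - m - 1).choose (n - 1) : ℝ)
              * mzvTrunc N ![m, a + n - m, b + c - n]
        + ∑ n ∈ Finset.Icc 1 c, ∑ m ∈ Finset.Icc 1 n,
            (-1 : ℝ) ^ (c - m) * ((a + n - m - 1).choose (a - 1) : ℝ)
              * ((b + c - n - 1).choose (b - 1) : ℝ)
              * (mzvTrunc N ![m] * mzvTrunc N ![a + n - m, b + c - n]))
      atTop (𝓝 (mzv ![a, b, c])) := by
  have h := tendsto_add_sum_mul_of_tendsto_zero (s := Finset.Icc 1 c) (t := fun n => Finset.Icc 1 n)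
    (mzvConverges_three ha hb hc).tendsto
    (fun n m => (-1 : ℝ) ^ (c - m) * ((a + n - m - 1).choose (a - 1) : ℝ)
      * ((b + c - n - 1).choose (b - 1) : ℝ))
    (e := fun n m N => mzvTrunc N ![m] * mzvTrunc N ![a + n - m, b + c - n] -
      truncProd m (a + n - m) (b + c - n) (N + 1))
    (fun n hn m hm => by
      rw [Finset.mem_Icc] at hn hm
      exact tendsto_mzvTrunc_mul_sub_truncProd hm.1 (by omega) (by omega))
  refine h.congr fun N => ?_
  simp only [mzvTrunc_three]
  rw [tripleSum_decomposition (N + 1) (show 1 ≤ a by omega) hb hc, add_assoc,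
    ← Finset.sum_add_distrib]
  simp only [← Finset.sum_add_distrib, ← mul_add, add_sub_cancel]

theorem tendsto_decomposition' {a b c : ℕ} (ha : 2 ≤ a) (hb : 1 ≤ b) (hc : 1 ≤ c) :
    Tendsto (fun N : ℕ =>
        (-1 : ℝ) ^ b * ∑ n ∈ Finset.Icc 1 c,
            ((∑ m ∈ Finset.Icc 1 a,
                (trinomial (b - 1) (a - m) (c - n) : ℝ) * mzvTrunc N ![m, a + b + c - m - n, n])
            + ∑ m ∈ Finset.Icc 1 (b + c - n),
                (-1 : ℝ) ^ m * ((b + c - n - 1).choose (b - 1) : ℝ)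
                  * ((a + b + c - m - n - 1).choose (a - 1) : ℝ)
                  * (mzvTrunc N ![m] * mzvTrunc N ![a + b + c - m - n, n]))
        + ∑ n ∈ Finset.Icc 1 b,
            (-1 : ℝ) ^ c * ((b + c - n - 1).choose (c - 1) : ℝ) * mzvTrunc N ![a, n, b + c - n])
      atTop (𝓝 (mzv ![a, b, c])) := by
  have h := tendsto_add_sum_mul_of_tendsto_zero (s := Finset.Icc 1 c)
    (t := fun n => Finset.Icc 1 (b + c - n))
    (mzvConverges_three ha hb hc).tendsto
    (fun n m => (-1 : ℝ) ^ b * ((-1 : ℝ) ^ m * ((b + c - n - 1).choose (b - 1) : ℝ)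
      * ((a + b + c - m - n - 1).choose (a - 1) : ℝ)))
    (e := fun n m N => mzvTrunc N ![m] * mzvTrunc N ![a + b + c - m - n, n] -
      truncProd m (a + b + c - m - n) n (N + 1))
    (fun n hn m hm => by
      rw [Finset.mem_Icc] at hn hm
      exact tendsto_mzvTrunc_mul_sub_truncProd hm.1 (by omega) hn.1)
  refine h.congr fun N => ?_
  simp only [mzvTrunc_three]
  rw [tripleSum_decomposition' (N + 1) (show 1 ≤ a by omega) hb hc, add_right_comm]
  congr 1
  simp only [mul_assoc ((-1 : ℝ) ^ b), ← Finset.mul_sum]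
  rw [← mul_add, ← Finset.sum_add_distrib]
  simp only [add_assoc, ← Finset.sum_add_distrib, ← mul_add, add_sub_cancel]

theorem mzv_decomposition {a b c : ℕ} (ha : 2 ≤ a) (hb : 1 ≤ b) (hc : 1 ≤ c) :
    mzv ![a, b, c] =
        (-1 : ℝ) ^ c * ∑ n ∈ Finset.Icc 1 b,
            ((b + c - n - 1).choose (c - 1) : ℝ) * mzv ![a, n, b + c - n]
        + (-1 : ℝ) ^ c * ∑ n ∈ Finset.Icc 1 c, ∑ m ∈ Finset.Icc 2 a,
            ((b + c - n - 1).choose (b - 1) : ℝ) * ((a + n - m - 1).choose (n - 1) : ℝ)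
              * mzv ![m, a + n - m, b + c - n]
        + ∑ n ∈ Finset.Icc 1 c, ∑ m ∈ Finset.Icc 2 n,
            (-1 : ℝ) ^ (c - m) * ((a + n - m - 1).choose (a - 1) : ℝ)
              * ((b + c - n - 1).choose (b - 1) : ℝ)
              * (mzv ![m] * mzv ![a + n - m, b + c - n])
        - (-1 : ℝ) ^ c * ∑ n ∈ Finset.Icc 1 c,
            ((a + n - 2).choose (a - 1) : ℝ) * ((b + c - n - 1).choose (b - 1) : ℝ)
              * (mzv ![a + n - 1, b + c - n, 1] + mzv ![a + n - 1, 1, b + c - n]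
                + mzv ![a + n, b + c - n] + mzv ![a + n - 1, b + c - n + 1]) := by
  -- The same truncated expression is given a second limit, by grouping its m = 1 terms into
  -- convergent combinations.
  refine tendsto_nhds_unique (tendsto_decomposition ha hb hc) ?_
  have hD : ∀ n ∈ Finset.Icc 1 c, Tendsto (fun N : ℕ => mzvTrunc N ![1] *
      mzvTrunc N ![a + n - 1, b + c - n] - mzvTrunc N ![1, a + n - 1, b + c - n]) atTop
      (𝓝 (mzv ![a + n - 1, b + c - n, 1] + mzv ![a + n - 1, 1, b + c - n]
        + mzv ![a + n, b + c - n] + mzv ![a + n - 1, b + c - n + 1])) := by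
    intro n hn
    rw [Finset.mem_Icc] at hn
    have := tendsto_mzvTrunc_one_mul_sub (p := a + n - 1) (q := b + c - n) (by omega) (by omega)
    rwa [show a + n - 1 + 1 = a + n by omega] at this
  have h := ((((tendsto_finsetSum (Finset.Icc 1 b) fun n hn =>
      (mzvConverges_three (p := a) (q := n) (r := b + c - n) ha
        (Finset.mem_Icc.1 hn).1 (by rw [Finset.mem_Icc] at hn; omega)).tendsto.const_mul
        ((b + c - n - 1).choose (c - 1) : ℝ)).const_mul ((-1 : ℝ) ^ c)).add
    ((tendsto_finsetSum (Finset.Icc 1 c) fun n hn =>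
      tendsto_finsetSum (Finset.Icc 2 a) fun m hm =>
      (mzvConverges_three (p := m) (q := a + n - m) (r := b + c - n)
        (Finset.mem_Icc.1 hm).1 (by rw [Finset.mem_Icc] at hn hm; omega)
        (by rw [Finset.mem_Icc] at hn hm; omega)).tendsto.const_mul
        (((b + c - n - 1).choose (b - 1) : ℝ) * ((a + n - m - 1).choose (n - 1) : ℝ))).const_mul
        ((-1 : ℝ) ^ c))).add
    (tendsto_finsetSum (Finset.Icc 1 c) fun n hn =>
      tendsto_finsetSum (Finset.Icc 2 n) fun m hm =>
      ((mzvConverges_one (p := m) (Finset.mem_Icc.1 hm).1).tendsto.mul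
        (mzvConverges_two (p := a + n - m) (q := b + c - n)
          (by rw [Finset.mem_Icc] at hn hm; omega)
          (by rw [Finset.mem_Icc] at hn hm; omega)).tendsto).const_mul
        ((-1 : ℝ) ^ (c - m) * ((a + n - m - 1).choose (a - 1) : ℝ)
              * ((b + c - n - 1).choose (b - 1) : ℝ)))).sub
    ((tendsto_finsetSum (Finset.Icc 1 c) fun n hn => (hD n hn).const_mul
      (((a + n - 2).choose (a - 1) : ℝ) * ((b + c - n - 1).choose (b - 1) : ℝ))).const_mul
      ((-1 : ℝ) ^ c))
  refine h.congr fun N => ?_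
  rw [add_assoc, add_assoc, add_sub_assoc]
  congr 1
  simp only [Finset.mul_sum]
  rw [← Finset.sum_add_distrib, ← Finset.sum_add_distrib, ← Finset.sum_sub_distrib]
  refine Finset.sum_congr rfl fun n hn => ?_
  rw [Finset.mem_Icc] at hn
  -- At m = 1 the triple sum and the product have opposite signs and, by symmetry of binomial
  -- coefficients, the same absolute coefficient.
  rw [sum_Icc_one_eq_add (show 1 ≤ a by omega), sum_Icc_one_eq_add hn.1,
    show a + n - 1 - 1 = a + n - 2 by omega, neg_one_pow_sub_eq_add hc,
    Nat.choose_symm_of_eq_add (show a + n - 2 = (a - 1) + (n - 1) by omega)]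
  ring

theorem mzv_decomposition' {a b c : ℕ} (ha : 2 ≤ a) (hb : 1 ≤ b) (hc : 1 ≤ c) :
    mzv ![a, b, c] =
        (-1 : ℝ) ^ b * ∑ n ∈ Finset.Icc 1 c,
            ((∑ m ∈ Finset.Icc 2 a,
                (trinomial (b - 1) (a - m) (c - n) : ℝ) * mzv ![m, a + b + c - m - n, n])
            + (∑ m ∈ Finset.Icc 2 (b + c - n),
                (-1 : ℝ) ^ m * ((b + c - n - 1).choose (b - 1) : ℝ)
                  * ((a + b + c - m - n - 1).choose (a - 1) : ℝ)
                  * (mzv ![m] * mzv ![a + b + c - m - n, n]))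
            - ((b + c - n - 1).choose (b - 1) : ℝ) * ((a + b + c - n - 2).choose (a - 1) : ℝ)
                * (mzv ![a + b + c - n - 1, n, 1] + mzv ![a + b + c - n - 1, 1, n]
                  + mzv ![a + b + c - n, n] + mzv ![a + b + c - n - 1, n + 1]))
        + ∑ n ∈ Finset.Icc 1 b,
            (-1 : ℝ) ^ c * ((b + c - n - 1).choose (c - 1) : ℝ) * mzv ![a, n, b + c - n] := by
  refine tendsto_nhds_unique (tendsto_decomposition' ha hb hc) ?_
  have hD : ∀ n ∈ Finset.Icc 1 c, Tendsto (fun N : ℕ => mzvTrunc N ![1] *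
      mzvTrunc N ![a + b + c - n - 1, n] - mzvTrunc N ![1, a + b + c - n - 1, n]) atTop
      (𝓝 (mzv ![a + b + c - n - 1, n, 1] + mzv ![a + b + c - n - 1, 1, n]
        + mzv ![a + b + c - n, n] + mzv ![a + b + c - n - 1, n + 1])) := by
    intro n hn
    rw [Finset.mem_Icc] at hn
    have := tendsto_mzvTrunc_one_mul_sub (p := a + b + c - n - 1) (q := n) (by omega) hn.1
    rwa [show a + b + c - n - 1 + 1 = a + b + c - n by omega] at this
  have h := ((tendsto_finsetSum (Finset.Icc 1 c) fun n hn =>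
      ((tendsto_finsetSum (Finset.Icc 2 a) fun m hm =>
        (mzvConverges_three (p := m) (q := a + b + c - m - n) (r := n)
          (Finset.mem_Icc.1 hm).1 (by rw [Finset.mem_Icc] at hn hm; omega)
          (Finset.mem_Icc.1 hn).1).tendsto.const_mul
          (trinomial (b - 1) (a - m) (c - n) : ℝ)).add
      (tendsto_finsetSum (Finset.Icc 2 (b + c - n)) fun m hm =>
        ((mzvConverges_one (p := m) (Finset.mem_Icc.1 hm).1).tendsto.mul
          (mzvConverges_two (p := a + b + c - m - n) (q := n)
            (by rw [Finset.mem_Icc] at hn hm; omega) (Finset.mem_Icc.1 hn).1).tendsto).const_mul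
          ((-1 : ℝ) ^ m * ((b + c - n - 1).choose (b - 1) : ℝ)
            * ((a + b + c - m - n - 1).choose (a - 1) : ℝ)))).sub
      ((hD n hn).const_mul (((b + c - n - 1).choose (b - 1) : ℝ) *
        ((a + b + c - n - 2).choose (a - 1) : ℝ)))).const_mul ((-1 : ℝ) ^ b)).add
    (tendsto_finsetSum (Finset.Icc 1 b) fun n hn =>
      (mzvConverges_three (p := a) (q := n) (r := b + c - n) ha
        (Finset.mem_Icc.1 hn).1 (by rw [Finset.mem_Icc] at hn; omega)).tendsto.const_mul
        ((-1 : ℝ) ^ c * ((b + c - n - 1).choose (c - 1) : ℝ)))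
  refine h.congr fun N => ?_
  congr 2
  refine Finset.sum_congr rfl fun n hn => ?_
  rw [Finset.mem_Icc] at hn
  -- At m = 1 the trinomial coefficient equals the product of binomials in front of the zeta
  -- product, so the two terms pair off with opposite signs.
  rw [sum_Icc_one_eq_add (show 1 ≤ a by omega), sum_Icc_one_eq_add (show 1 ≤ b + c - n by omega),
    trinomial_eq_choose_mul_choose, show b - 1 + (c - n) = b + c - n - 1 by omega,
    show b - 1 + (a - 1) + (c - n) = a + b + c - n - 2 by omega,
    show a + b + c - 1 - n = a + b + c - n - 1 by omega,
    show a + b + c - n - 1 - 1 = a + b + c - n - 2 by omega,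
    ← Nat.choose_symm_of_eq_add
      (show a + b + c - n - 2 = (a - 1) + (b + c - n - 1) by omega)]
  push_cast
  ring

end Decomposition

theorem mainTheorem7 :
    -- the non-divergent sums of lengths one, two and three converge
    (∀ p : ℕ, 2 ≤ p → MZVConverges ![p]) ∧
    (∀ p q : ℕ, 2 ≤ p → 1 ≤ q → MZVConverges ![p, q]) ∧
    (∀ p q r : ℕ, 2 ≤ p → 1 ≤ q → 1 ≤ r → MZVConverges ![p, q, r]) ∧
    -- elimination of the divergent combination `ζ(1) ζ(p,q) - ζ(1,p,q)`
    (∀ p q : ℕ, 2 ≤ p → 1 ≤ q →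
      Tendsto (fun N : ℕ => mzvTrunc N ![1] * mzvTrunc N ![p, q] - mzvTrunc N ![1, p, q]) atTop
        (𝓝 (mzv ![p, q, 1] + mzv ![p, 1, q] + mzv ![p + 1, q] + mzv ![p, q + 1]))) ∧
    ∀ a b c : ℕ, 2 ≤ a → 1 ≤ b → 1 ≤ c →
      -- the decomposition, all sums on the right being cut off at `N`
      Tendsto (fun N : ℕ =>
          (-1 : ℝ) ^ c * ∑ n ∈ Finset.Icc 1 b,
              ((b + c - n - 1).choose (c - 1) : ℝ) * mzvTrunc N ![a, n, b + c - n]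
          + (-1 : ℝ) ^ c * ∑ n ∈ Finset.Icc 1 c, ∑ m ∈ Finset.Icc 1 a,
              ((b + c - n - 1).choose (b - 1) : ℝ) * ((a + n - m - 1).choose (n - 1) : ℝ)
                * mzvTrunc N ![m, a + n - m, b + c - n]
          + ∑ n ∈ Finset.Icc 1 c, ∑ m ∈ Finset.Icc 1 n,
              (-1 : ℝ) ^ (c - m) * ((a + n - m - 1).choose (a - 1) : ℝ)
                * ((b + c - n - 1).choose (b - 1) : ℝ)
                * (mzvTrunc N ![m] * mzvTrunc N ![a + n - m, b + c - n]))
        atTop (𝓝 (mzv ![a, b, c])) ∧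
      -- the decomposition in terms of convergent sums only
      mzv ![a, b, c] =
          (-1 : ℝ) ^ c * ∑ n ∈ Finset.Icc 1 b,
              ((b + c - n - 1).choose (c - 1) : ℝ) * mzv ![a, n, b + c - n]
          + (-1 : ℝ) ^ c * ∑ n ∈ Finset.Icc 1 c, ∑ m ∈ Finset.Icc 2 a,
              ((b + c - n - 1).choose (b - 1) : ℝ) * ((a + n - m - 1).choose (n - 1) : ℝ)
                * mzv ![m, a + n - m, b + c - n]
          + ∑ n ∈ Finset.Icc 1 c, ∑ m ∈ Finset.Icc 2 n,
              (-1 : ℝ) ^ (c - m) * ((a + n - m - 1).choose (a - 1) : ℝ)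
                * ((b + c - n - 1).choose (b - 1) : ℝ)
                * (mzv ![m] * mzv ![a + n - m, b + c - n])
          - (-1 : ℝ) ^ c * ∑ n ∈ Finset.Icc 1 c,
              ((a + n - 2).choose (a - 1) : ℝ) * ((b + c - n - 1).choose (b - 1) : ℝ)
                * (mzv ![a + n - 1, b + c - n, 1] + mzv ![a + n - 1, 1, b + c - n]
                  + mzv ![a + n, b + c - n] + mzv ![a + n - 1, b + c - n + 1]) ∧
      -- the alternative decomposition, all sums on the right being cut off at `N`
      Tendsto (fun N : ℕ =>
          (-1 : ℝ) ^ b * ∑ n ∈ Finset.Icc 1 c,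
              ((∑ m ∈ Finset.Icc 1 a,
                  (trinomial (b - 1) (a - m) (c - n) : ℝ) * mzvTrunc N ![m, a + b + c - m - n, n])
              + ∑ m ∈ Finset.Icc 1 (b + c - n),
                  (-1 : ℝ) ^ m * ((b + c - n - 1).choose (b - 1) : ℝ)
                    * ((a + b + c - m - n - 1).choose (a - 1) : ℝ)
                    * (mzvTrunc N ![m] * mzvTrunc N ![a + b + c - m - n, n]))
          + ∑ n ∈ Finset.Icc 1 b,
              (-1 : ℝ) ^ c * ((b + c - n - 1).choose (c - 1) : ℝ) * mzvTrunc N ![a, n, b + c - n])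
        atTop (𝓝 (mzv ![a, b, c])) ∧
      -- the alternative decomposition in terms of convergent sums only
      mzv ![a, b, c] =
          (-1 : ℝ) ^ b * ∑ n ∈ Finset.Icc 1 c,
              ((∑ m ∈ Finset.Icc 2 a,
                  (trinomial (b - 1) (a - m) (c - n) : ℝ) * mzv ![m, a + b + c - m - n, n])
              + (∑ m ∈ Finset.Icc 2 (b + c - n),
                  (-1 : ℝ) ^ m * ((b + c - n - 1).choose (b - 1) : ℝ)
                    * ((a + b + c - m - n - 1).choose (a - 1) : ℝ)
                    * (mzv ![m] * mzv ![a + b + c - m - n, n]))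
              - ((b + c - n - 1).choose (b - 1) : ℝ) * ((a + b + c - n - 2).choose (a - 1) : ℝ)
                  * (mzv ![a + b + c - n - 1, n, 1] + mzv ![a + b + c - n - 1, 1, n]
                    + mzv ![a + b + c - n, n] + mzv ![a + b + c - n - 1, n + 1]))
          + ∑ n ∈ Finset.Icc 1 b,
              (-1 : ℝ) ^ c * ((b + c - n - 1).choose (c - 1) : ℝ) * mzv ![a, n, b + c - n] := by
  exact ⟨fun _ => mzvConverges_one, fun _ _ => mzvConverges_two, fun _ _ _ => mzvConverges_three,
    fun _ _ => tendsto_mzvTrunc_one_mul_sub, fun _ _ _ ha hb hc =>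
      ⟨tendsto_decomposition ha hb hc, mzv_decomposition ha hb hc,
        tendsto_decomposition' ha hb hc, mzv_decomposition' ha hb hc⟩⟩
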